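/- Let $\sigma(n)=\sum_{d\mid n} d$, and let the D'Arcais polynomials be defined by $P_0^{\sigma}(x)=1$ and \[ P_n^{\sigma}(x)=\frac{x}{n}\sum_{k=1}^{n}\sigma(k)\,P_{n-k}^{\sigma}(x)\qquad (n\ge 1). \] For $n\ge 1$ put \[ \Delta_n^{\sigma}(x)=\bigl(P_n^{\sigma}(x)\bigr)^{n+1}-\bigl(P_{n+1}^{\sigma}(x)\bigr)^{n}. \] Then for every integer $n$ with $6\le n\le 150$ the polynomial $\Delta_n^{\sigma}$ has a largest real zero $x_n^{\sigma}$, and $x_n^{\sigma}<1$. -/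

import Mathlib

open Polynomial

noncomputable section

/-- The generalized D'Arcais polynomials `P_n^g` attached to an arithmetic function `g`:
`P_0 = 1` and `P_n = (x / n) * ∑_{k = 1}^{n} g(k) P_{n - k}` for `n ≥ 1`
(below, `n` is written `m + 1` and `k` is written `j + 1`). -/
def dArcaisPoly (g : ℕ → ℝ) : ℕ → ℝ[X]
  | 0 => 1
  | m + 1 => C (1 / ((m + 1 : ℕ) : ℝ)) * X *
      ∑ j : Fin (m + 1), C (g ((j : ℕ) + 1)) * dArcaisPoly g (m - (j : ℕ))
  decreasing_by omega

theorem dArcaisPoly_zero (g : ℕ → ℝ) : dArcaisPoly g 0 = 1 := by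
  rw [dArcaisPoly]

/-- The defining recursion with the summation index running from `1` to `n`. -/
theorem dArcaisPoly_rec (g : ℕ → ℝ) (n : ℕ) (hn : 1 ≤ n) :
    dArcaisPoly g n =
      C (1 / (n : ℝ)) * X * ∑ k ∈ Finset.Icc 1 n, C (g k) * dArcaisPoly g (n - k) := by
  obtain ⟨m, rfl⟩ : ∃ m, n = m + 1 := ⟨n - 1, by omega⟩
  rw [dArcaisPoly, Fin.sum_univ_eq_sum_range
    (fun j => C (g (j + 1)) * dArcaisPoly g (m - j)) (m + 1)]
  congr 1
  rw [← Finset.Ico_add_one_right_eq_Icc, Finset.sum_Ico_eq_sum_range]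
  refine Finset.sum_congr (by simp) fun j _ => ?_
  rw [add_comm 1 j, Nat.add_sub_add_right]

/-- `Δ_n^g = (P_n^g)^(n+1) - (P_{n+1}^g)^n`. -/
def deltaPoly (g : ℕ → ℝ) (n : ℕ) : ℝ[X] :=
  dArcaisPoly g n ^ (n + 1) - dArcaisPoly g (n + 1) ^ n

/-- The sum-of-divisors function `σ(n) = ∑_{d ∣ n} d`, with real values. -/
def sigmaReal (n : ℕ) : ℝ := (ArithmeticFunction.sigma 1 n : ℝ)

end

open Polynomial

/-! Put `F_n(y) = n! P_n(1 + y)`, which has natural coefficients. For `n ≤ 150` a computation shows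
that `(n + 1) F_n' F_{n+1} - n F_{n+1}' F_n` has no negative coefficient, so `F_n ^ (n+1) / F_{n+1}
^ n` is monotone on `y ≥ 0` (`derivative_inequality`, `monotoneOn_pow_div_pow`). A numerical check
at `y = 0`, valid from `n = 6` on, then gives `Δ_n > 0` on `[1, ∞)` (`dArcaisPoly_pow_lt`). Thus
`Δ_n ≠ 0` has finitely many roots, all below `1`, and `0` is one of them. The coefficients are
compared all at once by evaluating at `2 ^ 1900` (`coeff_le_coeff_of_land`). -/

/-! ### Kernel-friendly evaluation of the recursion -/

/-- Evaluates the natural number `n` before passing it on, which keeps kernel reduction strict. -/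
def forceNat {α : Type} (n : ℕ) (f : ℕ → α) : α :=
  Nat.rec (f 0) (fun m _ => f (Nat.succ m)) n

theorem forceNat_eq {α : Type} (n : ℕ) (f : ℕ → α) : forceNat n f = f n := by
  cases n <;> rfl

/-- The weighted sum `c * ∑ j, ss[j] * m (m - 1) ⋯ (m - j + 1) * as[j]`. -/
def weightedSum : List ℕ → List ℕ → ℕ → ℕ → ℕ
  | s :: ss, a :: as, c, m => s * c * a + weightedSum ss as (c * m) (m - 1)
  | _, _, _, _ => 0

/-- Runs the recursion for the values at `z` of `n! P_n(1 + z)` and of its derivative, for `k` steps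
from `n` on, and applies the test `T` to each two consecutive pairs of values. -/
def runTest (T : ℕ → ℕ → ℕ → ℕ → ℕ → Bool) (z : ℕ) (ss : List ℕ) :
    ℕ → ℕ → List ℕ → List ℕ → Bool
  | 0, _, _, _ => true
  | k + 1, n, fs, gs =>
    forceNat (weightedSum ss fs 1 n) fun w =>
    forceNat ((z + 1) * w) fun f =>
    forceNat (w + (z + 1) * weightedSum ss gs 1 n) fun g =>
    -- Values are stored newest first, so the heads belong to index `n`; the default `0` is never
    -- reached from nonempty lists.
    T n (fs.headD 0) (gs.headD 0) f g && runTest T z ss k (n + 1) (f :: fs) (g :: gs)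

/-- The sum of the divisors of `k` that are at most `m`. -/
def divisorSum (k : ℕ) : ℕ → ℕ
  | 0 => 0
  | m + 1 => (bif Nat.beq (k % (m + 1)) 0 then m + 1 else 0) + divisorSum k m

/-- The list `σ(1), …, σ(L)`. -/
def sigmaList (L : ℕ) : List ℕ := (List.range' 1 L).map fun k => divisorSum k k

/-- The list `a (n - 1), …, a 0`. -/
def revList (a : ℕ → ℕ) : ℕ → List ℕ
  | 0 => []
  | n + 1 => a n :: revList a n

theorem divisorSum_eq_sum (k m : ℕ) :
    divisorSum k m = ∑ d ∈ Finset.range m, if (d + 1) ∣ k then d + 1 else 0 := by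
  induction m with
  | zero => rfl
  | succ m ih =>
    rw [divisorSum, ih, Finset.sum_range_succ, add_comm]
    congr 1
    by_cases h : (m + 1) ∣ k
    · simp [h, Nat.mod_eq_zero_of_dvd h]
    · have h' : Nat.beq (k % (m + 1)) 0 = false :=
        Bool.eq_false_iff.2 fun hb => h (Nat.dvd_of_mod_eq_zero (Nat.eq_of_beq_eq_true hb))
      simp [h, h']

theorem divisorSum_self (k : ℕ) : divisorSum k k = ArithmeticFunction.sigma 1 k := by
  rw [divisorSum_eq_sum, ArithmeticFunction.sigma_one_apply, Nat.divisors, Finset.sum_filter,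
    Finset.sum_Ico_eq_sum_range]
  simp [add_comm]

/-- Peeling off heads shifts `i` and builds the falling factorial in `c`. The sum stops with the
shorter list, so one list of `σ` values serves every `m < L`. -/
theorem weightedSum_eq_sum (s a : ℕ → ℕ) (m : ℕ) : ∀ (i c L : ℕ), m + 1 ≤ L →
    weightedSum ((List.range' i L).map s) (revList a (m + 1)) c m =
      c * ∑ j ∈ Finset.range (m + 1), s (i + j) * m.descFactorial j * a (m - j) := by
  induction m with
  | zero =>
    rintro i c (_ | L) hL
    · omega
    · simp [weightedSum, revList, List.range'_succ]
      ring
  | succ m ih =>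
    rintro i c (_ | L) hL
    · omega
    · rw [List.range'_succ, List.map_cons, revList, weightedSum, Nat.add_sub_cancel,
        ih (i + 1) _ L (by omega), Finset.sum_range_succ' _ (m + 1), mul_add c (Finset.sum _ _), add_comm (s i * c * a (m + 1)), mul_assoc c, Finset.mul_sum]
      congr 1
      · congr 1
        refine Finset.sum_congr rfl fun j _ => ?_
        rw [Nat.succ_descFactorial_succ, Nat.add_sub_add_right, add_right_comm i 1 j, add_assoc i j]
        ring
      · simp
        ring

/-- The polynomial `n! P_n(1 + X)`, which has natural number coefficients. -/
noncomputable def shiftedPoly : ℕ → ℕ[X]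
  | 0 => 1
  | m + 1 => (X + 1) * ∑ j : Fin (m + 1),
      C (ArithmeticFunction.sigma 1 ((j : ℕ) + 1) * m.descFactorial j) * shiftedPoly (m - (j : ℕ))
  decreasing_by omega

theorem shiftedPoly_succ (m : ℕ) :
    shiftedPoly (m + 1) = (X + 1) * ∑ j ∈ Finset.range (m + 1),
      C (ArithmeticFunction.sigma 1 (j + 1) * m.descFactorial j) * shiftedPoly (m - j) := by
  rw [shiftedPoly, Fin.sum_univ_eq_sum_range
    (fun j => C (ArithmeticFunction.sigma 1 (j + 1) * m.descFactorial j) * shiftedPoly (m - j))]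

/-- Integrality comes from `m! = (m - j)! * m.descFactorial j`, applied to `(m + 1)!` times the
recursion. -/
theorem eval_shiftedPoly (n : ℕ) (y : ℝ) :
    ((shiftedPoly n).map (Nat.castRingHom ℝ)).eval y =
      n.factorial * (dArcaisPoly sigmaReal n).eval (y + 1) := by
  induction n using Nat.strong_induction_on with
  | _ n ih =>
    rcases n with _ | m
    · simp [shiftedPoly, dArcaisPoly_zero]
    · rw [shiftedPoly_succ, dArcaisPoly, Fin.sum_univ_eq_sum_range
        (fun j => C (sigmaReal (j + 1)) * dArcaisPoly sigmaReal (m - j))]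
      simp only [Polynomial.map_mul, Polynomial.map_add, Polynomial.map_sum, map_X,
        Polynomial.map_one, eval_mul, eval_add, eval_X, eval_one, eval_finsetSum, eval_C,
        Nat.factorial_succ, Nat.cast_mul, eq_natCast, Polynomial.map_natCast, eval_natCast]
      have hm : ((m + 1 : ℕ) : ℝ) ≠ 0 := by positivity
      have hcancel (S : ℝ) : ((m + 1 : ℕ) : ℝ) * m.factorial *
          (1 / ((m + 1 : ℕ) : ℝ) * (y + 1) * S) = (y + 1) * (m.factorial * S) := by
        field_simp
      rw [hcancel, Finset.mul_sum _ _ (m.factorial : ℝ)]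
      refine congrArg ((y + 1) * ·) (Finset.sum_congr rfl fun j hj => ?_)
      have hj' : j ≤ m := by simpa [Nat.lt_succ_iff] using hj
      rw [ih (m - j) (by omega), ← Nat.factorial_mul_descFactorial hj', sigmaReal]
      push_cast
      ring

theorem runTest_spec (T : ℕ → ℕ → ℕ → ℕ → ℕ → Bool) (z L k : ℕ) : ∀ n, n + k ≤ L →
    runTest T z (sigmaList L) k n (revList (fun i => (shiftedPoly i).eval z) (n + 1))
      (revList (fun i => (derivative (shiftedPoly i)).eval z) (n + 1)) = true →
    ∀ i, n ≤ i → i < n + k →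
      T i ((shiftedPoly i).eval z) ((derivative (shiftedPoly i)).eval z)
        ((shiftedPoly (i + 1)).eval z) ((derivative (shiftedPoly (i + 1))).eval z) = true := by
  induction k with
  | zero => intros; omega
  | succ k ih =>
    intro n hn hrun i hi hik
    have hf : (shiftedPoly (n + 1)).eval z = (z + 1) * weightedSum (sigmaList L)
        (revList (fun i => (shiftedPoly i).eval z) (n + 1)) 1 n := by
      rw [sigmaList, weightedSum_eq_sum _ _ _ _ _ _ (by omega), shiftedPoly_succ]
      simp [eval_finsetSum, divisorSum_self, add_comm 1]
    have hg : (derivative (shiftedPoly (n + 1))).eval z = weightedSum (sigmaList L)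
        (revList (fun i => (shiftedPoly i).eval z) (n + 1)) 1 n + (z + 1) *
        weightedSum (sigmaList L)
          (revList (fun i => (derivative (shiftedPoly i)).eval z) (n + 1)) 1 n := by
      rw [sigmaList, weightedSum_eq_sum _ _ _ _ _ _ (by omega),
        weightedSum_eq_sum _ _ _ _ _ _ (by omega), shiftedPoly_succ]
      simp [eval_finsetSum, divisorSum_self, add_comm 1, derivative_mul]
    rw [runTest, forceNat_eq, forceNat_eq, forceNat_eq, ← hf, ← hg, Bool.and_eq_true] at hrun
    rcases hi.eq_or_lt with rfl | hlt
    · exact hrun.1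
    · exact ih (n + 1) (by omega) hrun.2 i hlt (by omega)

theorem runTest_zero_spec {T : ℕ → ℕ → ℕ → ℕ → ℕ → Bool} {z L : ℕ}
    (h : runTest T z (sigmaList L) L 0 [1] [0] = true) {i : ℕ} (hi : i < L) :
    T i ((shiftedPoly i).eval z) ((derivative (shiftedPoly i)).eval z)
      ((shiftedPoly (i + 1)).eval z) ((derivative (shiftedPoly (i + 1))).eval z) = true :=
  runTest_spec T z L L 0 (by omega) (by simpa [revList, shiftedPoly] using h) i (by omega) (by omega)

/-! ### Coefficientwise comparison through Kronecker substitution -/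

theorem digit_sum_eq {B : ℕ} (k : ℕ) : ∀ (w : ℕ → ℕ), (∀ i, w i < B) → ∀ i < k,
    (∑ j ∈ Finset.range k, w j * B ^ j) / B ^ i % B = w i := by
  induction k with
  | zero => intros; omega
  | succ k ih =>
    intro w hw i hi
    have hB : 0 < B := (Nat.zero_le _).trans_lt (hw 0)
    have hs : ∑ j ∈ Finset.range (k + 1), w j * B ^ j =
        w 0 + B * ∑ j ∈ Finset.range k, w (j + 1) * B ^ j := by
      rw [Finset.sum_range_succ', Finset.mul_sum, add_comm]
      congr 1
      · simp
      · exact Finset.sum_congr rfl fun j _ => by ring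
    rw [hs]
    rcases i with _ | i
    · simp [Nat.mod_eq_of_lt (hw 0)]
    · rw [pow_succ', ← Nat.div_div_eq_div_mul, Nat.add_mul_div_left _ _ hB,
        Nat.div_eq_of_lt (hw 0), zero_add]
      exact ih (fun j => w (j + 1)) (fun j => hw _) i (by omega)

/-- The number with `k` digits `2 ^ (N - 1)` in base `2 ^ N`. -/
def digitMask (N k : ℕ) : ℕ := 2 ^ (N - 1) * (((2 ^ N) ^ k - 1) / (2 ^ N - 1))

theorem digitMask_eq_sum {N : ℕ} (hN : 1 ≤ N) (k : ℕ) :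
    digitMask N k = ∑ j ∈ Finset.range k, 2 ^ (N - 1) * (2 ^ N) ^ j := by
  rw [digitMask, ← Finset.mul_sum, Nat.geomSum_eq]
  calc 2 = 2 ^ 1 := rfl
    _ ≤ 2 ^ N := Nat.pow_le_pow_right (by norm_num) hN

theorem natDegree_lt_of_eval_lt {p : ℕ[X]} {B k : ℕ} (hB : 1 ≤ B) (h : p.eval B < B ^ k)
    (hk : 1 ≤ k) : p.natDegree < k := by
  by_contra! hle
  have hp : p ≠ 0 := by
    rintro rfl
    simp at hle
    omega
  have h1 : p.coeff p.natDegree * B ^ p.natDegree ≤ p.eval B := by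
    rw [eval_eq_sum_range]
    exact Finset.single_le_sum (f := fun i => p.coeff i * B ^ i) (fun _ _ => Nat.zero_le _)
      (by simp)
  have h2 : 1 ≤ p.coeff p.natDegree :=
    Nat.one_le_iff_ne_zero.2 (leadingCoeff_ne_zero.2 hp)
  have h3 := Nat.pow_le_pow_right hB hle
  nlinarith

theorem coeff_le_eval_one (p : ℕ[X]) (i : ℕ) : p.coeff i ≤ p.eval 1 := by
  rw [eval_eq_sum_range]
  simp only [one_pow, mul_one]
  by_cases hi : i ≤ p.natDegree
  · exact Finset.single_le_sum (f := fun i => p.coeff i) (fun _ _ => Nat.zero_le _)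
      (by simpa [Nat.lt_succ_iff] using hi)
  · simp [coeff_eq_zero_of_natDegree_lt (not_le.1 hi)]

/-- Each `u_j + 2 ^ (N - 1) - v_j` lies strictly between `0` and `2 ^ N`, so these are true base `2
^ N` digits, without carry or borrow. The top bit of a digit is set exactly when `v_j ≤ u_j`, and
one `&&&` tests all of them. -/
theorem coeff_le_coeff_of_land {U V : ℕ[X]} {N k : ℕ} (hN : 1 ≤ N) (hk : 1 ≤ k)
    (hU : U.eval 1 < 2 ^ (N - 1)) (hV : V.eval 1 < 2 ^ (N - 1))
    (hUk : U.eval (2 ^ N) < (2 ^ N) ^ k) (hVk : V.eval (2 ^ N) < (2 ^ N) ^ k)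
    (hland : (U.eval (2 ^ N) + digitMask N k - V.eval (2 ^ N)) &&& digitMask N k =
      digitMask N k) (i : ℕ) : V.coeff i ≤ U.coeff i := by
  have hB : 1 ≤ 2 ^ N := Nat.one_le_two_pow
  have hUd := natDegree_lt_of_eval_lt hB hUk hk
  have hVd := natDegree_lt_of_eval_lt hB hVk hk
  rcases le_or_gt k i with hki | hik
  · simp [coeff_eq_zero_of_natDegree_lt (hVd.trans_le hki)]
  have hNN : 2 ^ N = 2 ^ (N - 1) + 2 ^ (N - 1) := by
    rw [← two_mul, ← pow_succ', Nat.sub_add_cancel hN]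
  have hu (j) : U.coeff j < 2 ^ (N - 1) := (coeff_le_eval_one U j).trans_lt hU
  have hv (j) : V.coeff j < 2 ^ (N - 1) := (coeff_le_eval_one V j).trans_lt hV
  set w : ℕ → ℕ := fun j => U.coeff j + 2 ^ (N - 1) - V.coeff j with hw
  have hwsum : U.eval (2 ^ N) + digitMask N k - V.eval (2 ^ N) =
      ∑ j ∈ Finset.range k, w j * (2 ^ N) ^ j := by
    rw [Nat.sub_eq_iff_eq_add']
    · rw [digitMask_eq_sum hN, eval_eq_sum_range' hUd, eval_eq_sum_range' hVd,
        ← Finset.sum_add_distrib, ← Finset.sum_add_distrib]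
      refine Finset.sum_congr rfl fun j _ => ?_
      rw [← add_mul, ← add_mul]
      congr 1
      have := hv j
      simp only [hw]
      omega
    · rw [digitMask_eq_sum hN, eval_eq_sum_range' hVd]
      exact (Finset.sum_le_sum fun j _ => Nat.mul_le_mul_right _ (hv j).le).trans
        (Nat.le_add_left _ _)
  have hdigit (x : ℕ) : x.testBit (N * i + (N - 1)) = (x / (2 ^ N) ^ i % 2 ^ N).testBit (N - 1) := by
    rw [← pow_mul, Nat.testBit_mod_two_pow, Nat.testBit_div_two_pow]
    simp [show N - 1 < N by omega, add_comm]
  have hbit : (w i).testBit (N - 1) = true := by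
    have hmask : (digitMask N k).testBit (N * i + (N - 1)) = true := by
      rw [hdigit, digitMask_eq_sum hN, digit_sum_eq k (fun _ => 2 ^ (N - 1)) _ i hik,
        Nat.testBit_two_pow_self]
      intro _
      have := Nat.two_pow_pos (N - 1)
      omega
    have h := hmask
    rw [← hland, Nat.testBit_and, hmask, Bool.and_true, hwsum, hdigit, digit_sum_eq k w _ i hik] at h
    · exact h
    · intro j
      have := hu j
      simp only [hw]
      omega
  have := Nat.ge_two_pow_of_testBit hbit
  have := hv i
  simp only [hw] at *
  omega

/-! ### The computations -/

/-- Sum-of-coefficients bound below `2 ^ 1899` for both sides of the derivative inequality. -/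
def boundTest (n f g f' g' : ℕ) : Bool :=
  Nat.blt ((n + 1) * g * f') (2 ^ (1900 - 1)) && Nat.blt (n * g' * f) (2 ^ (1900 - 1))

/-- Compares the base `2 ^ 1900` digits of both sides of the derivative inequality. -/
def coeffTest (n f g f' g' : ℕ) : Bool :=
  -- Both sides have degree at most `2 * n ≤ 300`, so `302` digits suffice.
  Nat.blt ((n + 1) * g * f') ((2 ^ 1900) ^ 302) && (Nat.blt (n * g' * f) ((2 ^ 1900) ^ 302) &&
    Nat.beq (Nat.land ((n + 1) * g * f' + digitMask 1900 302 - n * g' * f) (digitMask 1900 302))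
      (digitMask 1900 302))

/-- The inequality `P_{n+1}(1) ^ n < P_n(1) ^ (n + 1)` for `6 ≤ n`, cleared of denominators. -/
def endpointTest (n f _g f' _g' : ℕ) : Bool :=
  Nat.blt n 6 ||
    Nat.blt (f' ^ n * n.factorial ^ (n + 1)) (f ^ (n + 1) * (n + 1).factorial ^ n)

/-- Evaluation at `1` gives coefficient sums, which bound every coefficient. -/
theorem runTest_boundTest : runTest boundTest 1 (sigmaList 151) 151 0 [1] [0] = true := by
  decide +kernel

theorem runTest_endpointTest : runTest endpointTest 0 (sigmaList 151) 151 0 [1] [0] = true := by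
  decide +kernel

theorem runTest_coeffTest :
    runTest coeffTest (2 ^ 1900) (sigmaList 151) 151 0 [1] [0] = true := by
  decide +kernel

/-! ### Monotonicity and conclusion -/

/-- `F_n(y) = n! P_n(1 + y)` as a real polynomial. -/
noncomputable def shiftedRealPoly (n : ℕ) : ℝ[X] := (shiftedPoly n).map (Nat.castRingHom ℝ)

theorem eval_map_le_eval_map {U V : ℕ[X]} (h : ∀ i, V.coeff i ≤ U.coeff i) {y : ℝ} (hy : 0 ≤ y) :
    (V.map (Nat.castRingHom ℝ)).eval y ≤ (U.map (Nat.castRingHom ℝ)).eval y := by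
  have hU : U.natDegree < max U.natDegree V.natDegree + 1 := by omega
  have hV : V.natDegree < max U.natDegree V.natDegree + 1 := by omega
  rw [eval_map, eval_map, eval₂_eq_sum_range' _ hU, eval₂_eq_sum_range' _ hV]
  refine Finset.sum_le_sum fun i _ => mul_le_mul_of_nonneg_right ?_ (pow_nonneg hy i)
  simpa using h i

theorem shiftedPoly_coeff_zero_pos (n : ℕ) : 0 < (shiftedPoly n).coeff 0 := by
  induction n using Nat.strong_induction_on with
  | _ n ih =>
    rcases n with _ | m
    · simp [shiftedPoly]
    · rw [shiftedPoly_succ, coeff_zero_eq_eval_zero]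
      simp only [eval_mul, eval_add, eval_X, eval_one, zero_add, one_mul, eval_finsetSum, eval_C]
      refine Finset.sum_pos (fun j hj => ?_) (by simp)
      have hj' : j ≤ m := by simpa [Nat.lt_succ_iff] using hj
      have h := ih (m - j) (by omega)
      rw [coeff_zero_eq_eval_zero] at h
      have h1 : 0 < ArithmeticFunction.sigma 1 (j + 1) := by
        rw [ArithmeticFunction.sigma_one_apply]
        exact Finset.sum_pos (fun d hd => Nat.pos_of_mem_divisors hd) (by simp)
      have h2 : 0 < m.descFactorial j := Nat.pos_of_ne_zero fun h0 =>
        (Nat.descFactorial_eq_zero_iff_lt.1 h0).not_ge hj'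
      positivity

theorem shiftedRealPoly_eval_pos (n : ℕ) {y : ℝ} (hy : 0 ≤ y) :
    0 < (shiftedRealPoly n).eval y := by
  have h := eval_map_le_eval_map (U := shiftedPoly n) (V := C ((shiftedPoly n).coeff 0))
    (fun i => by rw [coeff_C]; split_ifs with hi <;> simp [hi]) hy
  have hpos : (0 : ℝ) < (shiftedPoly n).coeff 0 := by exact_mod_cast shiftedPoly_coeff_zero_pos n
  refine hpos.trans_le (le_of_eq_of_le ?_ h)
  simp

theorem derivative_inequality {n : ℕ} (hn : n ≤ 150) {y : ℝ} (hy : 0 ≤ y) :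
    n * (derivative (shiftedRealPoly (n + 1))).eval y * (shiftedRealPoly n).eval y ≤
      (n + 1) * (derivative (shiftedRealPoly n)).eval y * (shiftedRealPoly (n + 1)).eval y := by
  have hb := runTest_zero_spec runTest_boundTest (i := n) (by omega)
  have hc := runTest_zero_spec runTest_coeffTest (i := n) (by omega)
  simp only [boundTest, coeffTest, Bool.and_eq_true, Nat.blt_eq] at hb hc
  have hland := Nat.eq_of_beq_eq_true hc.2.2
  have hcoeff := coeff_le_coeff_of_land (N := 1900) (k := 302) (by norm_num) (by norm_num)
    (U := C (n + 1) * derivative (shiftedPoly n) * shiftedPoly (n + 1))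
    (V := C n * derivative (shiftedPoly (n + 1)) * shiftedPoly n)
    (by rw [eval_mul, eval_mul, eval_C]; exact hb.1)
    (by rw [eval_mul, eval_mul, eval_C]; exact hb.2)
    (by rw [eval_mul, eval_mul, eval_C]; exact hc.1)
    (by rw [eval_mul, eval_mul, eval_C]; exact hc.2.1)
    (by rw [eval_mul, eval_mul, eval_C, eval_mul, eval_mul, eval_C]; exact hland)
  have h := eval_map_le_eval_map hcoeff hy
  simpa [shiftedRealPoly, derivative_map] using h

theorem monotoneOn_pow_div_pow (n : ℕ) (hn : n ≤ 150) :
    MonotoneOn (fun y : ℝ => (shiftedRealPoly n).eval y ^ (n + 1) /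
      (shiftedRealPoly (n + 1)).eval y ^ n) (Set.Ici 0) := by
  have hne (y : ℝ) (hy : 0 ≤ y) : (shiftedRealPoly (n + 1)).eval y ^ n ≠ 0 :=
    (pow_pos (shiftedRealPoly_eval_pos _ hy) n).ne'
  have hder (y : ℝ) (hy : 0 ≤ y) := (((shiftedRealPoly n).hasDerivAt y).pow (n + 1)).div
    (((shiftedRealPoly (n + 1)).hasDerivAt y).pow n) (hne y hy)
  refine monotoneOn_of_deriv_nonneg (convex_Ici 0)
    (fun y hy => (hder y hy).continuousAt.continuousWithinAt)
    (fun y hy => (hder y (interior_subset hy)).differentiableAt.differentiableWithinAt)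
    fun y hy => ?_
  have hy0 : 0 ≤ y := interior_subset hy
  refine le_of_le_of_eq ?_ (hder y hy0).deriv.symm
  have hf := shiftedRealPoly_eval_pos n hy0
  have hf' := shiftedRealPoly_eval_pos (n + 1) hy0
  have hd := derivative_inequality hn hy0
  refine div_nonneg ?_ (sq_nonneg _)
  -- The exponent `n - 1` from differentiating the denominator truncates at `n = 0`, where the
  -- quotient is constant.
  rcases n with _ | n
  · simp [shiftedRealPoly, shiftedPoly]
  · simp only [Pi.pow_apply, Nat.add_sub_cancel]
    -- The numerator of the quotient rule, factored.
    have : 0 ≤ (shiftedRealPoly (n + 1)).eval y ^ (n + 1) *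
        (shiftedRealPoly (n + 1 + 1)).eval y ^ n *
        (((n + 1 : ℕ) + 1) * (derivative (shiftedRealPoly (n + 1))).eval y *
          (shiftedRealPoly (n + 1 + 1)).eval y - (n + 1 : ℕ) *
          (derivative (shiftedRealPoly (n + 1 + 1))).eval y *
            (shiftedRealPoly (n + 1)).eval y) :=
      mul_nonneg (by positivity) (sub_nonneg.2 hd)
    refine this.trans_eq ?_
    push_cast
    ring

theorem dArcaisPoly_pow_lt {n : ℕ} (hn : 6 ≤ n) (hn' : n ≤ 150) {x : ℝ} (hx : 1 ≤ x) :
    (dArcaisPoly sigmaReal (n + 1)).eval x ^ n < (dArcaisPoly sigmaReal n).eval x ^ (n + 1) := by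
  have hy : 0 ≤ x - 1 := sub_nonneg.2 hx
  have heval (m : ℕ) : (shiftedRealPoly m).eval (x - 1) =
      m.factorial * (dArcaisPoly sigmaReal m).eval x := by
    rw [shiftedRealPoly, eval_shiftedPoly, sub_add_cancel]
  have hmono := monotoneOn_pow_div_pow n hn' (Set.mem_Ici.2 le_rfl) (Set.mem_Ici.2 hy) hy
  have he := runTest_zero_spec runTest_endpointTest (i := n) (by omega)
  simp only [endpointTest, Bool.or_eq_true, Nat.blt_eq, hn.not_gt, false_or] at he
  have hzero (m : ℕ) : (shiftedRealPoly m).eval 0 = ((shiftedPoly m).eval 0 : ℕ) := by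
    rw [shiftedRealPoly, eval_map, ← Nat.cast_zero, eval₂_at_natCast]
    simp
  have he' : (shiftedRealPoly (n + 1)).eval 0 ^ n * (n.factorial : ℝ) ^ (n + 1) <
      (shiftedRealPoly n).eval 0 ^ (n + 1) * ((n + 1).factorial : ℝ) ^ n := by
    rw [hzero, hzero]
    exact_mod_cast he
  have h0 := pow_pos (shiftedRealPoly_eval_pos (n + 1) le_rfl) n
  have h1 := pow_pos (shiftedRealPoly_eval_pos (n + 1) hy) n
  have hfac : (0 : ℝ) < (n.factorial : ℝ) ^ (n + 1) := by positivity
  have hfac' : (0 : ℝ) < ((n + 1).factorial : ℝ) ^ n := by positivity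
  -- The left side is the threshold that the quotient of the `F`'s must exceed for `Δ_n > 0`.
  have hlt : (n.factorial : ℝ) ^ (n + 1) / ((n + 1).factorial : ℝ) ^ n <
      (shiftedRealPoly n).eval 0 ^ (n + 1) / (shiftedRealPoly (n + 1)).eval 0 ^ n := by
    rw [div_lt_div_iff₀ hfac' h0]
    linarith
  have h2 := hlt.trans_le hmono
  rw [div_lt_div_iff₀ hfac' h1, heval, heval, mul_pow, mul_pow] at h2
  refine lt_of_mul_lt_mul_left (a := (n.factorial : ℝ) ^ (n + 1) * ((n + 1).factorial : ℝ) ^ n)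
    ?_ (by positivity)
  linarith

theorem mainTheorem6 (n : ℕ) (hn : 6 ≤ n) (hn' : n ≤ 150) :
    ∃ x : ℝ, IsGreatest {y : ℝ | (deltaPoly sigmaReal n).IsRoot y} x ∧ x < 1 := by
  have hroot (y : ℝ) (hy : (deltaPoly sigmaReal n).IsRoot y) : y < 1 := by
    by_contra! h
    have hlt := dArcaisPoly_pow_lt hn hn' h
    rw [IsRoot.def, deltaPoly, eval_sub, eval_pow, eval_pow] at hy
    linarith
  have hne : deltaPoly sigmaReal n ≠ 0 := by
    intro h
    have := hroot 1 (by simp [h])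
    exact lt_irrefl _ this
  have hzero (m : ℕ) (hm : 1 ≤ m) : (dArcaisPoly sigmaReal m).eval 0 = 0 := by
    simp [dArcaisPoly_rec sigmaReal m hm]
  have hmem : (deltaPoly sigmaReal n).IsRoot 0 := by
    rw [IsRoot.def, deltaPoly, eval_sub, eval_pow, eval_pow, hzero n (by omega),
      hzero (n + 1) (by omega), zero_pow (by omega), zero_pow (by omega), sub_zero]
  obtain ⟨x, hx, hmax⟩ := Set.exists_max_image _ id (finite_setOfPred_isRoot hne) ⟨0, hmem⟩
  exact ⟨x, ⟨hx, fun y hy => hmax y hy⟩, hroot x hx⟩
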